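/- All graphs are finite and simple. For natural numbers $n,k,g,\lambda$, an $egr(n,k,g,\lambda)$ graph is a $k$-regular graph of order $n$ and girth $g$ each of whose edges is contained in exactly $\lambda$ distinct cycles of length $g$. Let $n(k,g,\lambda)$ (respectively $n_2(k,g,\lambda)$) be the smallest order of an $egr(n,k,g,\lambda)$ graph (respectively of a bipartite one), over all $n$ for which such a graph exists. Let $G$ be an $egr(n,k,g,\lambda)$ graph with $g$ even, let $v$ be any vertex of $G$, and let $c(\ell,k)$ denote the number of closed walks of length $\ell$ in $G$ starting at $v$ that contain no cycle, i.e. whose edges form an acyclic graph. If $g\equiv 0 \pmod 4$, then $c(g,k)-c(\frac g2,k)^2+k\lambda>0$ and $$n(k,g,\lambda)\ \ge\ \frac{c(g,k)+k\lambda+k^{g}-2c(\frac g2,k)k^{g/2}}{c(g,k)-c(\frac g2,k)^2+k\lambda},$$ and, if a bipartite edge-girth-regular graph with parameters $k,g,\lambda$ exists, $$n_2(k,g,\lambda)\ \ge\ 2\,\frac{c(g,k)+k\lambda+k^{g}-2c(\frac g2,k)k^{g/2}}{c(g,k)-c(\frac g2,k)^2+k\lambda}.$$ If $g\equiv 2 \pmod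 4$, then $c(g,k)+k\lambda>0$ and $$n(k,g,\lambda)\ \ge\ \frac{c(g,k)+k\lambda+k^g}{c(g,k)+k\lambda},$$ and, if a bipartite edge-girth-regular graph with parameters $k,g,\lambda$ exists, $$n_2(k,g,\lambda)\ \ge\ \frac{2k^g}{c(g,k)+k\lambda}.$$ -/

import Mathlib

universe u

namespace EdgeGirthRegular

variable {V : Type u}

/-- `H` is a cycle of length `g` in `G`, regarded as a subgraph (so that the base point and the
orientation of a closed walk running around it do not matter). -/
def IsCycleSubgraph (G : SimpleGraph V) (g : ℕ) (H : G.Subgraph) : Prop :=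
  ∃ (v : V) (p : G.Walk v v), p.IsCycle ∧ p.length = g ∧ p.toSubgraph = H

/-- `G` is an edge-girth-regular graph `egr(n, k, g, lam)`: it has order `n`, it is `k`-regular, it
has girth `g`, and each of its edges lies in exactly `lam` distinct cycles of length `g`.
The extended girth of a forest is `⊤`, so such a graph has a cycle. -/
structure IsEGR [Fintype V] (G : SimpleGraph V) [DecidableRel G.Adj] (n k g lam : ℕ) : Prop where
  order : Fintype.card V = n
  regular : G.IsRegularOfDegree k
  girth : G.egirth = (g : ℕ∞)
  cycles : ∀ e ∈ G.edgeSet, {H : G.Subgraph | IsCycleSubgraph G g H ∧ e ∈ H.edgeSet}.ncard = lam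

/-- The set of orders of the graphs `egr(n, k, g, lam)`. -/
def orders (k g lam : ℕ) : Set ℕ :=
  {n | ∃ (G : SimpleGraph (Fin n)) (_ : DecidableRel G.Adj), IsEGR G n k g lam}

/-- The set of orders of the bipartite graphs `egr(n, k, g, lam)`. -/
def bipartiteOrders (k g lam : ℕ) : Set ℕ :=
  {n | ∃ (G : SimpleGraph (Fin n)) (_ : DecidableRel G.Adj), IsEGR G n k g lam ∧ G.IsBipartite}

/-- `n(k, g, lam)`: the smallest order of an edge-girth-regular graph with parameters `k, g, lam`
(meaningful when such a graph exists). -/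
noncomputable def minOrder (k g lam : ℕ) : ℕ := sInf (orders k g lam)

/-- `n₂(k, g, lam)`: the smallest order of a bipartite edge-girth-regular graph with parameters
`k, g, lam` (meaningful when such a graph exists). -/
noncomputable def minBipartiteOrder (k g lam : ℕ) : ℕ := sInf (bipartiteOrders k g lam)

/-- The number of closed walks of length `l` starting at `v` that contain no cycle, i.e. whose
edges form an acyclic graph. -/
noncomputable def c (G : SimpleGraph V) (v : V) (l : ℕ) : ℕ :=
  {p : G.Walk v v | p.length = l ∧ (SimpleGraph.fromEdgeSet {e | e ∈ p.edges}).IsAcyclic}.ncard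

end EdgeGirthRegular

/-! Let `A` be the adjacency matrix, `l = g / 2`, `a = c(l, k)` and `C = c(g, k) + kλ`. The
diagonals of `A ^ l` and `A ^ g` are constantly `a` and `C`: a closed walk shorter than the girth
contains no cycle, and one of length `g` either contains none or is one of the `kλ` cycle walks at
its start. Hence the traces are `na` and `nC`.

`A ^ l` has the eigenvalue `k ^ l` on the all-ones vector, and Cauchy–Schwarz on the orthogonal
complement gives `(na - k^l)² ≤ (nC - k^(2l))(n - 1)`, which simplifies to the general bound. In a
bipartite graph the eigenvector for `-k` is split off as well. If `l` is odd then `a = 0`, as trees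
have no odd closed walks, and in the bipartite case the nonnegativity of the remaining eigenvalues
of `A ^ g` suffices.

The minimum order may be attained by a graph other than `G`, so `c` must depend only on `k` and the
length. Expanding powers of `A` in non-backtracking walks shows this: up to the girth they obey the
recurrence of the `k`-regular tree (`treeCount`, `IsEGR.c_eq`). -/

namespace EdgeGirthRegular

open SimpleGraph Finset

section Walks

variable {V : Type u} {G : SimpleGraph V}

/-! ### Non-backtracking walks -/

/-- A walk is non-backtracking if any two consecutive edges differ. -/
def IsNonBacktracking {u v : V} (p : G.Walk u v) : Prop := p.edges.IsChain (· ≠ ·)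

theorem IsNonBacktracking.of_cons {u v w : V} {h : G.Adj u v} {p : G.Walk v w}
    (hp : IsNonBacktracking (Walk.cons h p)) : IsNonBacktracking p := by
  unfold IsNonBacktracking at hp ⊢
  rw [Walk.edges_cons] at hp
  exact hp.tail

theorem isNonBacktracking_of_isTrail {u v : V} {p : G.Walk u v} (hp : p.IsTrail) :
    IsNonBacktracking p :=
  List.Pairwise.isChain hp.edges_nodup

/-- In a non-backtracking walk whose tail is a path, the first edge does not reappear in the
tail. -/
theorem IsNonBacktracking.not_mem_edges {u v w : V} {h : G.Adj u v} {p : G.Walk v w}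
    (hp : IsNonBacktracking (Walk.cons h p)) (hpath : p.IsPath) : s(u, v) ∉ p.edges := by
  cases p with
  | nil => simp
  | cons h' q =>
    intro hmem
    rw [Walk.edges_cons, List.mem_cons] at hmem
    rcases hmem with hmem | hmem
    · unfold IsNonBacktracking at hp
      rw [Walk.edges_cons, Walk.edges_cons, List.isChain_cons_cons] at hp
      exact hp.1 hmem
    · rw [Walk.cons_isPath_iff] at hpath
      exact hpath.2 (q.snd_mem_support_of_mem_edges hmem)

/-- A non-backtracking walk shorter than the girth is a path. -/
theorem IsNonBacktracking.isPath {g : ℕ} (hg : (g : ℕ∞) ≤ G.egirth) {u v : V} {p : G.Walk u v}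
    (hp : IsNonBacktracking p) (hlen : p.length < g) : p.IsPath := by
  classical
  induction p with
  | nil => exact Walk.IsPath.nil
  | @cons u x v h p ih =>
    rw [Walk.length_cons] at hlen
    have hpath := ih hp.of_cons (by omega)
    rw [Walk.cons_isPath_iff]
    refine ⟨hpath, fun hu => ?_⟩
    -- A return to `u` would close a cycle shorter than the girth.
    have hcyc : (Walk.cons h (p.takeUntil u hu)).IsCycle := by
      rw [Walk.cons_isCycle_iff]
      exact ⟨hpath.takeUntil hu, fun he =>
        hp.not_mem_edges hpath (p.edges_takeUntil_subset_edges hu he)⟩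
    have h1 := hg.trans (egirth_le_length hcyc)
    rw [Walk.length_cons] at h1
    have h2 := p.length_takeUntil_le_length hu
    have h3 : g ≤ (p.takeUntil u hu).length + 1 := by exact_mod_cast h1
    omega

/-- A nonempty closed non-backtracking walk whose length is at most the girth is a cycle. -/
theorem IsNonBacktracking.isCycle {g : ℕ} (hg : (g : ℕ∞) ≤ G.egirth) {v : V} {p : G.Walk v v}
    (hp : IsNonBacktracking p) (hpos : p.length ≠ 0) (hlen : p.length ≤ g) : p.IsCycle := by
  cases p with
  | nil => simp at hpos
  | cons h p =>
    rw [Walk.length_cons] at hlen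
    have hpath := hp.of_cons.isPath hg (by omega)
    rw [Walk.cons_isCycle_iff]
    exact ⟨hpath, hp.not_mem_edges hpath⟩

/-! ### Walks containing no cycle -/

/-- A closed walk whose edges contain a cycle is at least as long as the girth, and is itself a
cycle if its length equals the girth. -/
theorem isAcyclic_or_isCycle {g : ℕ} (hg : (g : ℕ∞) ≤ G.egirth) {v : V} (p : G.Walk v v)
    (hpg : p.length ≤ g) :
    (fromEdgeSet {e | e ∈ p.edges}).IsAcyclic ∨ p.length = g ∧ p.IsCycle := by
  classical
  rw [or_iff_not_imp_left]
  intro hnot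
  unfold IsAcyclic at hnot
  push Not at hnot
  obtain ⟨w, q, hq⟩ := hnot
  have hsub : ∀ e ∈ q.edges, e ∈ p.edges := fun e he => by
    have := q.edges_subset_edgeSet he
    rw [edgeSet_fromEdgeSet] at this
    exact this.1
  have hqG : ∀ e ∈ q.edges, e ∈ G.edgeSet := fun e he => p.edges_subset_edgeSet (hsub e he)
  have hlen := hg.trans (egirth_le_length (hq.transfer hqG))
  rw [Walk.length_transfer] at hlen
  have hlen' : g ≤ q.length := by exact_mod_cast hlen
  -- The cycle `q` has at least `g` distinct edges, all on `p`, which has at most `g` steps; so `p`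
  -- repeats no edge.
  have hcard : q.edges.toFinset.card = q.length := by
    rw [List.toFinset_card_of_nodup hq.edges_nodup, Walk.length_edges]
  have hle : q.edges.toFinset.card ≤ p.edges.toFinset.card :=
    card_le_card fun e he => by
      rw [List.mem_toFinset] at he ⊢
      exact hsub e he
  have hle2 := List.toFinset_card_le p.edges
  rw [Walk.length_edges] at hle2
  have hg3 := hq.three_le_length
  have htrail : p.IsTrail := by
    rw [Walk.isTrail_def, ← Multiset.coe_nodup, ← Multiset.toFinset_card_eq_card_iff_nodup]
    change p.edges.toFinset.card = p.edges.length
    rw [Walk.length_edges]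
    omega
  exact ⟨by omega, (isNonBacktracking_of_isTrail htrail).isCycle hg (by omega) hpg⟩

theorem not_isAcyclic_of_isCycle {v : V} {p : G.Walk v v} (hp : p.IsCycle) :
    ¬ (fromEdgeSet {e | e ∈ p.edges}).IsAcyclic := by
  intro h
  refine h _ (hp.transfer (H := fromEdgeSet {e | e ∈ p.edges}) fun e he => ?_)
  rw [edgeSet_fromEdgeSet]
  exact ⟨he, G.not_isDiag_of_mem_edgeSet (p.edges_subset_edgeSet he)⟩

/-! ### Cycle walks and cycle subgraphs -/

/-- Two paths with the same endpoints are equal if one runs along edges of the other. -/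
theorem eq_of_isPath_of_edges_subset {u v : V} {p q : G.Walk u v} (hp : p.IsPath) (hq : q.IsPath)
    (hsub : ∀ e ∈ q.edges, e ∈ p.edges) : q = p := by
  induction p with
  | nil => exact Walk.eq_nil_iff_nil.2 (Walk.isPath_iff_nil.1 hq)
  | @cons u x v h p ih =>
    rw [Walk.cons_isPath_iff] at hp
    cases q with
    | nil => exact absurd p.end_mem_support hp.2
    | @cons _ y _ h' q =>
      rw [Walk.cons_isPath_iff] at hq
      have hxy : y = x := by
        have := hsub s(u, y) (by simp)
        rw [Walk.edges_cons, List.mem_cons] at this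
        rcases this with this | this
        · exact (Sym2.congr_right.1 this)
        · exact absurd (p.fst_mem_support_of_mem_edges this) hp.2
      subst hxy
      rw [ih hp.1 hq.1 fun e he => ?_]
      have := hsub e (by rw [Walk.edges_cons]; exact List.mem_cons_of_mem _ he)
      rw [Walk.edges_cons, List.mem_cons] at this
      rcases this with rfl | this
      · exact absurd (q.fst_mem_support_of_mem_edges he) hq.2
      · exact this

/-- The cycle subgraphs through an edge correspond to the cycle walks starting with it. -/
theorem ncard_isCycle_cons {v x : V} (h : G.Adj v x) (l : ℕ) :
    {p : G.Walk x v | p.length = l ∧ (Walk.cons h p).IsCycle}.ncard =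
      {H : G.Subgraph | IsCycleSubgraph G (l + 1) H ∧ s(v, x) ∈ H.edgeSet}.ncard := by
  classical
  refine Set.ncard_congr (fun p _ => (Walk.cons h p).toSubgraph) ?_ ?_ ?_
  · rintro p ⟨hl, hp⟩
    refine ⟨⟨v, _, hp, by rw [Walk.length_cons, hl], rfl⟩, ?_⟩
    rw [Walk.mem_edges_toSubgraph]
    simp
  · rintro p q ⟨-, hp⟩ ⟨-, hq⟩ heq
    rw [Walk.cons_isCycle_iff] at hp hq
    refine (eq_of_isPath_of_edges_subset hp.1 hq.1 fun e he => ?_).symm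
    have h1 : e ∈ (Walk.cons h q).toSubgraph.edgeSet := by
      rw [Walk.mem_edges_toSubgraph, Walk.edges_cons]
      exact List.mem_cons_of_mem _ he
    rw [← heq, Walk.mem_edges_toSubgraph, Walk.edges_cons, List.mem_cons] at h1
    rcases h1 with rfl | h1
    · exact absurd he hq.2
    · exact h1
  · rintro H ⟨⟨u, p, hp, hl, rfl⟩, he⟩
    rw [Walk.mem_edges_toSubgraph] at he
    have hv := p.fst_mem_support_of_mem_edges he
    -- Rotate the cycle to start at `v`; then `x` is its second or its penultimate vertex, and in
    -- the latter case reverse it.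
    obtain ⟨q, hq, hql, hqs, hsnd⟩ : ∃ q : G.Walk v v, q.IsCycle ∧ q.length = l + 1 ∧
        q.toSubgraph = p.toSubgraph ∧ q.snd = x := by
      have hr := hp.rotate hv
      have hrs := p.toSubgraph_rotate hv
      have hadj : x ∈ (p.rotate v hv).toSubgraph.neighborSet v := by
        rw [hrs]
        change s(v, x) ∈ p.toSubgraph.edgeSet
        rwa [Walk.mem_edges_toSubgraph]
      rw [hr.neighborSet_toSubgraph_endpoint] at hadj
      rcases hadj with hx | hx
      · exact ⟨_, hr, by rw [Walk.length_rotate, hl], hrs, hx.symm⟩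
      · refine ⟨_, hr.reverse, by rw [Walk.length_reverse, Walk.length_rotate, hl],
          by rw [Walk.toSubgraph_reverse, hrs], ?_⟩
        rw [Walk.snd_reverse]
        exact hx.symm
    cases q with
    | nil => simp at hql
    | cons h' q =>
      rw [Walk.snd_cons] at hsnd
      subst hsnd
      exact ⟨q, ⟨by simpa using hql, hq⟩, hqs⟩

/-! ### Counting walks by their first step -/

theorem finite_walks_length [Fintype V] (u v : V) (l : ℕ) :
    {p : G.Walk u v | p.length = l}.Finite := by
  classical
  exact Set.toFinite _

/-- `P` is arbitrary so that one bijection serves both non-backtracking walks and cycles. -/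
theorem ncard_walk_succ [Fintype V] [DecidableRel G.Adj] {u v : V} (l : ℕ)
    (P : G.Walk u v → Prop) :
    {p : G.Walk u v | p.length = l + 1 ∧ P p}.ncard =
      ∑ x : G.neighborSet u,
        {p : G.Walk x v | p.length = l ∧
          P (Walk.cons ((G.mem_neighborSet u x).1 x.2) p)}.ncard := by
  classical
  have hfin : ∀ x : G.neighborSet u,
      {p : G.Walk x v | p.length = l ∧ P (Walk.cons ((G.mem_neighborSet u x).1 x.2) p)}.Finite :=
    fun x => (finite_walks_length x.1 v l).subset fun p hp => hp.1
  have : ∀ x : G.neighborSet u, Finite {p : G.Walk x v | p.length = l ∧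
      P (Walk.cons ((G.mem_neighborSet u x).1 x.2) p)} :=
    fun x => (hfin x).to_subtype
  simp only [← Nat.card_coe_set_eq]
  rw [← Nat.card_sigma]
  refine (Nat.card_congr (Equiv.ofBijective (fun y => ⟨Walk.cons
    ((G.mem_neighborSet u y.1).1 y.1.2) y.2.1, by rw [Walk.length_cons, y.2.2.1], y.2.2.2⟩)
    ⟨?_, ?_⟩)).symm
  · rintro ⟨⟨x, hx⟩, p, hp⟩ ⟨⟨y, hy⟩, q, hq⟩ heq
    simp only [Subtype.mk.injEq, Walk.cons.injEq] at heq
    obtain ⟨rfl, heq⟩ := heq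
    obtain rfl := eq_of_heq heq
    rfl
  · rintro ⟨p, hl, hp⟩
    cases p with
    | nil => simp at hl
    | @cons _ x _ h p => exact ⟨⟨⟨x, h⟩, p, by simpa using hl, hp⟩, rfl⟩

/-- The number of non-backtracking walks of length `j` between two vertices. -/
noncomputable def nbMatrix (G : SimpleGraph V) (j : ℕ) : Matrix V V ℕ :=
  Matrix.of fun u v => {p : G.Walk u v | p.length = j ∧ IsNonBacktracking p}.ncard

/-- The number of walks of length `j` from `w` to `v` that are non-backtracking and do not start
with the step from `w` to `u`. -/
noncomputable def nbAvoid (G : SimpleGraph V) (j : ℕ) (u w v : V) : ℕ :=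
  {p : G.Walk w v | p.length = j ∧ (s(u, w) :: p.edges).IsChain (· ≠ ·)}.ncard

theorem nbMatrix_zero [Fintype V] [DecidableEq V] : nbMatrix G 0 = 1 := by
  ext u v
  rw [nbMatrix, Matrix.of_apply, Matrix.one_apply]
  split_ifs with h
  · subst h
    rw [Set.ncard_eq_one]
    refine ⟨Walk.nil, Set.eq_singleton_iff_unique_mem.2 ⟨⟨rfl, by simp [IsNonBacktracking]⟩, ?_⟩⟩
    rintro p ⟨hp, -⟩
    exact Walk.eq_nil_iff_nil.2 (Walk.length_eq_zero_iff.1 hp)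
  · rw [Set.ncard_eq_zero ((finite_walks_length _ _ _).subset fun p hp => hp.1)]
    ext p
    simp only [Set.mem_ofPred_eq, Set.mem_empty_iff_false, iff_false, not_and]
    exact fun hp => absurd (Walk.eq_of_length_eq_zero hp) h

theorem nbAvoid_zero [Fintype V] [DecidableEq V] (u w v : V) :
    nbAvoid G 0 u w v = (1 : Matrix V V ℕ) w v := by
  rw [← nbMatrix_zero (G := G), nbMatrix, Matrix.of_apply, nbAvoid]
  congr 1
  ext p
  simp only [Set.mem_ofPred_eq, and_congr_right_iff]
  intro hp
  have : p.edges = [] := List.eq_nil_of_length_eq_zero (by rw [Walk.length_edges, hp])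
  simp [IsNonBacktracking, this]

theorem sum_neighborSet [Fintype V] [DecidableRel G.Adj] (u : V) (f : V → ℕ) :
    ∑ x : G.neighborSet u, f x = ∑ x ∈ G.neighborFinset u, f x :=
  (Finset.sum_subtype _ (fun x => G.mem_neighborFinset u x) f).symm

/-! ### Recurrences for non-backtracking walks. -/

variable [Fintype V] [DecidableRel G.Adj]

theorem nbMatrix_succ (j : ℕ) (u v : V) :
    nbMatrix G (j + 1) u v = ∑ w ∈ G.neighborFinset u, nbAvoid G j u w v := by
  rw [nbMatrix, Matrix.of_apply, ncard_walk_succ, ← sum_neighborSet]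
  rfl

/-- Split by whether the first step from `w` goes to `u`; if it does, the rest may not step straight
back to `w`. -/
theorem nbAvoid_succ_add {u w : V} (h : G.Adj u w) (j : ℕ) (v : V) :
    nbAvoid G (j + 1) u w v + nbAvoid G j w u v = nbMatrix G (j + 1) w v := by
  classical
  have hu : u ∈ G.neighborFinset w := by simpa using h.symm
  rw [nbMatrix_succ, nbAvoid, ncard_walk_succ, ← Finset.sum_erase_add _ _ hu]
  congr 1
  have key : ∀ x : G.neighborSet w, {p : G.Walk x v | p.length = j ∧
      (s(u, w) :: (Walk.cons ((G.mem_neighborSet w x).1 x.2) p).edges).IsChain (· ≠ ·)}.ncard =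
      if (x : V) = u then 0 else nbAvoid G j w x v := by
    rintro ⟨x, hx⟩
    simp only [Walk.edges_cons, List.isChain_cons_cons]
    split_ifs with hxu
    · subst hxu
      rw [Set.ncard_eq_zero ((finite_walks_length _ _ _).subset fun p hp => hp.1)]
      ext p
      simp [Sym2.eq_swap]
    · rw [nbAvoid]
      congr 1
      ext p
      have : s(u, w) ≠ s(w, x) := by
        rw [Sym2.eq_swap]
        exact fun h => hxu (Sym2.congr_right.1 h).symm
      simp [this]
  rw [Finset.sum_congr rfl fun x _ => key x,
    sum_neighborSet (G := G) w fun x => if x = u then 0 else nbAvoid G j w x v,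
    ← Finset.sum_erase_add _ _ hu, if_pos rfl, add_zero]
  exact Finset.sum_congr rfl fun x hx => if_neg (Finset.ne_of_mem_erase hx)

variable [DecidableEq V] {k : ℕ}

theorem adjMatrix_mul_nbMatrix_zero : G.adjMatrix ℕ * nbMatrix G 0 = nbMatrix G 1 := by
  ext u v
  rw [adjMatrix_mul_apply, nbMatrix_succ]
  exact Finset.sum_congr rfl fun w _ => by rw [nbAvoid_zero, nbMatrix_zero]

-- Prefixing a step `u → w` to a non-backtracking walk from `w` either keeps it non-backtracking or
-- is undone at once by its first step; the last sum counts the second case.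
omit [DecidableEq V] in
theorem adjMatrix_mul_nbMatrix_succ (j : ℕ) (u v : V) :
    (G.adjMatrix ℕ * nbMatrix G (j + 1)) u v =
      nbMatrix G (j + 2) u v + ∑ w ∈ G.neighborFinset u, nbAvoid G j w u v := by
  rw [adjMatrix_mul_apply, nbMatrix_succ, ← Finset.sum_add_distrib]
  exact Finset.sum_congr rfl fun w hw => (nbAvoid_succ_add (by simpa using hw) j v).symm

theorem adjMatrix_mul_nbMatrix_one (hk : G.IsRegularOfDegree k) :
    G.adjMatrix ℕ * nbMatrix G 1 = nbMatrix G 2 + k • nbMatrix G 0 := by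
  ext u v
  rw [adjMatrix_mul_nbMatrix_succ, Matrix.add_apply, Matrix.smul_apply]
  simp only [nbAvoid_zero, nbMatrix_zero, Finset.sum_const, card_neighborFinset_eq_degree, hk u]

-- The factor is `k - 1`, not `k` as in the preceding lemma: after the immediate return to `u` the
-- remaining walk is nonempty, and its first step excludes one neighbour.
omit [DecidableEq V] in
theorem adjMatrix_mul_nbMatrix_add_two (hk : G.IsRegularOfDegree k) (j : ℕ) :
    G.adjMatrix ℕ * nbMatrix G (j + 2) = nbMatrix G (j + 3) + (k - 1) • nbMatrix G (j + 1) := by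
  ext u v
  rw [adjMatrix_mul_nbMatrix_succ, Matrix.add_apply, Matrix.smul_apply]
  congr 1
  -- Expanded over first steps, the added entry supplies for each `w` exactly the walks that the
  -- summand omits.
  have h : ∑ w ∈ G.neighborFinset u, nbAvoid G (j + 1) w u v + nbMatrix G (j + 1) u v =
      k * nbMatrix G (j + 1) u v := by
    rw [nbMatrix_succ j u v, ← Finset.sum_add_distrib, ← nbMatrix_succ,
      Finset.sum_congr rfl fun w hw => nbAvoid_succ_add (G := G)
        ((G.mem_neighborFinset u w).1 hw).symm j v,
      Finset.sum_const, card_neighborFinset_eq_degree, hk u, smul_eq_mul]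
  rw [smul_eq_mul, Nat.sub_one_mul]
  omega

omit [Fintype V] [DecidableRel G.Adj] [DecidableEq V] in
theorem nbMatrix_diag_eq_isCycle {g : ℕ} (hg : (g : ℕ∞) ≤ G.egirth) {j : ℕ} (hj : j ≠ 0)
    (hjg : j ≤ g) (v : V) :
    nbMatrix G j v v = {p : G.Walk v v | p.length = j ∧ p.IsCycle}.ncard := by
  rw [nbMatrix, Matrix.of_apply]
  congr 1
  ext p
  simp only [Set.mem_ofPred_eq, and_congr_right_iff]
  rintro rfl
  exact ⟨fun hp => hp.isCycle hg hj hjg, fun hp => isNonBacktracking_of_isTrail hp.isTrail⟩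

/-- The number of closed walks of length `i + j` at a vertex of the `k`-regular tree whose last `j`
steps form a non-backtracking walk. -/
def treeCount (k : ℕ) : ℕ → ℕ → ℕ
  | 0, 0 => 1
  | 0, _ + 1 => 0
  | i + 1, 0 => treeCount k i 1
  | i + 1, 1 => treeCount k i 2 + k * treeCount k i 0
  | i + 1, j + 2 => treeCount k i (j + 3) + (k - 1) * treeCount k i (j + 1)

/-- Moving one factor `A` across by the recurrences reproduces `treeCount`. The leading term keeps
`i + j` and the other lowers it by two, so `L` is picked up only along leading terms, with
coefficient one. -/
theorem pow_mul_nbMatrix_diag (hk : G.IsRegularOfDegree k) {g L : ℕ} (v : V) (hg3 : 0 < g)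
    (hzero : ∀ j, j ≠ 0 → j < g → nbMatrix G j v v = 0) (hL : nbMatrix G g v v = L) (i : ℕ) :
    ∀ j, i + j ≤ g → (G.adjMatrix ℕ ^ i * nbMatrix G j) v v =
      treeCount k i j + if i + j = g then L else 0 := by
  induction i with
  | zero =>
    intro j hj
    rw [pow_zero, one_mul, zero_add]
    cases j with
    | zero =>
      rw [if_neg (by omega), nbMatrix_zero]
      simp [treeCount]
    | succ j =>
      split_ifs with h
      · rw [treeCount, zero_add, h, hL]
      · rw [hzero _ (by omega) (by omega)]
        simp [treeCount]
  | succ i ih =>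
    intro j hj
    rw [pow_succ, mul_assoc]
    rcases j with _ | _ | j
    · rw [adjMatrix_mul_nbMatrix_zero, ih 1 (by omega)]
      simp [treeCount]
    · rw [adjMatrix_mul_nbMatrix_one hk, mul_add, Matrix.add_apply, ih 2 (by omega),
        Matrix.mul_smul, Matrix.smul_apply, ih 0 (by omega), if_neg (by omega : ¬ i + 0 = g),
        show i + 1 + (0 + 1) = i + 2 by ring, zero_add, treeCount, smul_eq_mul]
      ring
    · rw [adjMatrix_mul_nbMatrix_add_two hk, mul_add, Matrix.add_apply, ih (j + 3) (by omega),
        Matrix.mul_smul, Matrix.smul_apply, ih (j + 1) (by omega),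
        if_neg (by omega : ¬ i + (j + 1) = g),
        show i + 1 + (j + 1 + 1) = i + (j + 3) by ring, treeCount, smul_eq_mul]
      ring

theorem adjMatrix_pow_apply_eq_ncard (l : ℕ) (u v : V) :
    (G.adjMatrix ℕ ^ l) u v = {p : G.Walk u v | p.length = l}.ncard := by
  rw [adjMatrix_pow_apply_eq_card_walk, ← Nat.card_coe_set_eq, Nat.card_eq_fintype_card]
  simp

theorem c_eq_of_lt {g l : ℕ} (hg : (g : ℕ∞) ≤ G.egirth) (hl : l < g) (v : V) :
    c G v l = (G.adjMatrix ℕ ^ l) v v := by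
  rw [adjMatrix_pow_apply_eq_ncard, c]
  congr 1
  ext p
  simp only [Set.mem_ofPred_eq, and_iff_left_iff_imp]
  rintro rfl
  exact (isAcyclic_or_isCycle hg p hl.le).resolve_right fun h => hl.ne h.1

theorem c_add_ncard_isCycle {g : ℕ} (hg : (g : ℕ∞) ≤ G.egirth) (v : V) :
    c G v g + {p : G.Walk v v | p.length = g ∧ p.IsCycle}.ncard = (G.adjMatrix ℕ ^ g) v v := by
  have hfin := finite_walks_length (G := G) v v g
  rw [adjMatrix_pow_apply_eq_ncard, c, ← Set.ncard_union_eq _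
    (hfin.subset fun p hp => hp.1) (hfin.subset fun p hp => hp.1)]
  · congr 1
    ext p
    simp only [Set.mem_union, Set.mem_ofPred_eq]
    constructor
    · rintro (h | h) <;> exact h.1
    · rintro rfl
      rcases isAcyclic_or_isCycle hg p le_rfl with h | h
      · exact Or.inl ⟨rfl, h⟩
      · exact Or.inr h
  · rw [Set.disjoint_left]
    exact fun p hp hp' => not_isAcyclic_of_isCycle hp'.2 hp.2

/-! ### Closed walks in edge-girth-regular graphs -/

variable {n g lam : ℕ}

omit [DecidableEq V] in
theorem IsEGR.le_egirth (hG : IsEGR G n k g lam) : (g : ℕ∞) ≤ G.egirth := hG.girth.ge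

omit [DecidableEq V] in
theorem IsEGR.exists_isCycle (hG : IsEGR G n k g lam) :
    ∃ (v : V) (p : G.Walk v v), p.IsCycle ∧ p.length = g := by
  have h : ¬ G.IsAcyclic := by
    rw [← egirth_eq_top, hG.girth]
    exact ENat.natCast_ne_top g
  obtain ⟨v, p, hp, hl⟩ := exists_egirth_eq_length.2 h
  rw [hG.girth] at hl
  exact ⟨v, p, hp, by exact_mod_cast hl.symm⟩

omit [DecidableEq V] in
theorem IsEGR.three_le (hG : IsEGR G n k g lam) : 3 ≤ g := by
  obtain ⟨v, p, hp, rfl⟩ := hG.exists_isCycle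
  exact hp.three_le_length

omit [DecidableEq V] in
theorem IsEGR.two_le (hG : IsEGR G n k g lam) : 2 ≤ k := by
  obtain ⟨v, p, hp, -⟩ := hG.exists_isCycle
  rw [← hG.regular v, ← card_neighborFinset_eq_degree, ← hp.ncard_neighborSet_toSubgraph_eq_two
    p.start_mem_support, ← Set.ncard_coe_finset, coe_neighborFinset]
  exact Set.ncard_le_ncard (p.toSubgraph.neighborSet_subset v) (Set.toFinite _)

-- Each of the `k` first steps begins `lam` cycle walks. A cycle through `v` is counted twice, once
-- per orientation, as it should be for walks.
omit [DecidableEq V] in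
theorem IsEGR.ncard_isCycle (hG : IsEGR G n k g lam) (v : V) :
    {p : G.Walk v v | p.length = g ∧ p.IsCycle}.ncard = k * lam := by
  obtain ⟨l, rfl⟩ : ∃ l, g = l + 1 := ⟨g - 1, by have := hG.three_le; omega⟩
  rw [ncard_walk_succ]
  have h : ∀ x : G.neighborSet v, {p : G.Walk x v | p.length = l ∧
      (Walk.cons ((G.mem_neighborSet v x).1 x.2) p).IsCycle}.ncard = lam := fun x => by
    rw [ncard_isCycle_cons]
    exact hG.cycles s(v, x) x.2
  rw [Finset.sum_congr rfl fun x _ => h x, Finset.sum_const, smul_eq_mul, Finset.card_univ,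
    card_neighborSet_eq_degree, hG.regular v]

theorem IsEGR.pow_diag (hG : IsEGR G n k g lam) (v : V) {l : ℕ} (hl : l ≤ g) :
    (G.adjMatrix ℕ ^ l) v v = treeCount k l 0 + if l = g then k * lam else 0 := by
  have h3 := hG.three_le
  have := pow_mul_nbMatrix_diag hG.regular (g := g) (L := k * lam) v (by omega) ?_ ?_ l 0 hl
  · rwa [nbMatrix_zero, mul_one] at this
  · intro j hj hjg
    rw [nbMatrix_diag_eq_isCycle hG.le_egirth hj hjg.le]
    rw [Set.ncard_eq_zero ((finite_walks_length _ _ _).subset fun p hp => hp.1)]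
    ext p
    simp only [Set.mem_ofPred_eq, Set.mem_empty_iff_false, iff_false, not_and]
    rintro rfl hp
    have h := hG.le_egirth.trans (egirth_le_length hp)
    have h' : g ≤ p.length := by exact_mod_cast h
    omega
  · rw [nbMatrix_diag_eq_isCycle hG.le_egirth (by omega) le_rfl, hG.ncard_isCycle]

-- The right side mentions neither `G` nor `v`, so values of `c` transfer between graphs with the
-- same parameters.
omit [DecidableEq V] in
theorem IsEGR.c_eq (hG : IsEGR G n k g lam) (v : V) {l : ℕ} (hl : l ≤ g) :
    c G v l = treeCount k l 0 := by
  classical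
  rcases hl.lt_or_eq with h | rfl
  · rw [c_eq_of_lt hG.le_egirth h, hG.pow_diag v hl, if_neg h.ne, add_zero]
  · have h1 := c_add_ncard_isCycle hG.le_egirth v
    rw [hG.pow_diag v le_rfl, if_pos rfl, hG.ncard_isCycle v] at h1
    omega

end Walks

/-! ### A trace inequality -/

section Matrix

open Matrix

variable {V : Type u} [Fintype V] [DecidableEq V]

omit [DecidableEq V] in
theorem trace_mul_transpose_eq_sum (M N : Matrix V V ℝ) :
    (M * Nᵀ).trace = ∑ x : V × V, M x.1 x.2 * N x.1 x.2 := by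
  rw [Fintype.sum_prod_type]
  simp [Matrix.trace, Matrix.mul_apply]

omit [DecidableEq V] in
theorem trace_mul_transpose_self_nonneg (M : Matrix V V ℝ) : 0 ≤ (M * Mᵀ).trace := by
  rw [trace_mul_transpose_eq_sum]
  exact Finset.sum_nonneg fun x _ => mul_self_nonneg _

omit [DecidableEq V] in
theorem trace_mul_transpose_sq_le (M N : Matrix V V ℝ) :
    (M * Nᵀ).trace ^ 2 ≤ (M * Mᵀ).trace * (N * Nᵀ).trace := by
  simp only [trace_mul_transpose_eq_sum, ← sq]
  exact Finset.sum_mul_sq_le_sq_mul_sq _ _ _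

variable {M Q : Matrix V V ℝ}

omit [DecidableEq V] in
theorem sub_mul_transpose_self (hM : M.IsSymm) (hQ : Q.IsSymm) (hMQ : Commute M Q)
    (hidem : Q * Q = Q) : (M - M * Q) * (M - M * Q)ᵀ = M * M - M * M * Q := by
  have h : (M - M * Q)ᵀ = M - M * Q := by
    rw [transpose_sub, transpose_mul, hM.eq, hQ.eq, hMQ.eq]
  have h' : M * Q * M = M * M * Q := by rw [mul_assoc, ← hMQ.eq, mul_assoc]
  rw [h, sub_mul, mul_sub, mul_sub, h', ← mul_assoc, ← mul_assoc (M * Q), h', mul_assoc (M * M),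
    hidem]
  abel

omit [DecidableEq V] in
theorem trace_mul_self_sub_nonneg (hM : M.IsSymm) (hQ : Q.IsSymm) (hMQ : Commute M Q)
    (hidem : Q * Q = Q) : 0 ≤ (M * M).trace - (M * M * Q).trace := by
  rw [← trace_sub, ← sub_mul_transpose_self hM hQ hMQ hidem]
  exact trace_mul_transpose_self_nonneg _

/-- The Cauchy–Schwarz inequality for the eigenvalues of a symmetric matrix on the kernel of an
orthogonal projection that commutes with it. -/
theorem trace_sub_sq_le (hM : M.IsSymm) (hQ : Q.IsSymm) (hMQ : Commute M Q) (hidem : Q * Q = Q) :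
    (M.trace - (M * Q).trace) ^ 2 ≤
      ((M * M).trace - (M * M * Q).trace) * (Fintype.card V - Q.trace) := by
  -- The last factor of the goal is the squared Frobenius norm of `1 - Q`, the dimension of the
  -- kernel of `Q`.
  have h := trace_mul_transpose_sq_le (M - M * Q) (1 - Q)
  rw [sub_mul_transpose_self hM hQ hMQ hidem, transpose_sub, transpose_one, hQ.eq] at h
  have h1 : (M - M * Q) * (1 - Q) = M - M * Q := by
    rw [mul_sub, mul_one, sub_mul, mul_assoc, hidem, sub_self, sub_zero]
  have h2 : (1 - Q) * (1 - Q) = 1 - Q := by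
    rw [mul_sub, mul_one, sub_mul, one_mul, hidem, sub_self, sub_zero]
  rwa [h1, h2, trace_sub, trace_sub, trace_sub, trace_one] at h

/-! ### Projections onto sign eigenvectors. -/

/-- The orthogonal projection onto the line spanned by a vector with entries `±1`. -/
noncomputable def signProj (s : V → ℝ) : Matrix V V ℝ :=
  (Fintype.card V : ℝ)⁻¹ • vecMulVec s s

omit [DecidableEq V] in
theorem isSymm_signProj (s : V → ℝ) : (signProj s).IsSymm := by
  rw [Matrix.IsSymm, signProj, transpose_smul, transpose_vecMulVec]

omit [DecidableEq V] in
theorem signProj_mul_signProj (s t : V → ℝ) :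
    signProj s * signProj t =
      ((Fintype.card V : ℝ)⁻¹ * (Fintype.card V : ℝ)⁻¹ * (s ⬝ᵥ t)) • vecMulVec s t := by
  rw [signProj, signProj, smul_mul_smul_comm, vecMulVec_mul_vecMulVec, vecMulVec_smul, smul_smul]

omit [DecidableEq V] in
theorem dotProduct_self_sign {s : V → ℝ} (hs : ∀ v, s v * s v = 1) :
    s ⬝ᵥ s = Fintype.card V := by
  simp [dotProduct, hs]

omit [DecidableEq V] in
theorem signProj_mul_self [Nonempty V] {s : V → ℝ} (hs : ∀ v, s v * s v = 1) :
    signProj s * signProj s = signProj s := by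
  have hn : (Fintype.card V : ℝ) ≠ 0 := Nat.cast_ne_zero.2 Fintype.card_ne_zero
  rw [signProj_mul_signProj, dotProduct_self_sign hs, inv_mul_cancel_right₀ hn, signProj]

omit [DecidableEq V] in
theorem trace_signProj [Nonempty V] {s : V → ℝ} (hs : ∀ v, s v * s v = 1) :
    (signProj s).trace = 1 := by
  have hn : (Fintype.card V : ℝ) ≠ 0 := Nat.cast_ne_zero.2 Fintype.card_ne_zero
  rw [signProj, trace_smul, trace_vecMulVec, dotProduct_self_sign hs, smul_eq_mul,
    inv_mul_cancel₀ hn]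

theorem pow_mul_signProj {A : Matrix V V ℝ} {s : V → ℝ} {μ : ℝ} (h : A *ᵥ s = μ • s) (l : ℕ) :
    A ^ l * signProj s = μ ^ l • signProj s := by
  induction l with
  | zero => simp
  | succ l ih =>
    rw [pow_succ, mul_assoc]
    have h1 : A * signProj s = μ • signProj s := by
      rw [signProj, mul_smul_comm, mul_vecMulVec, h, smul_vecMulVec, smul_comm]
    rw [h1, mul_smul_comm, ih, smul_smul, pow_succ, mul_comm]

theorem commute_pow_signProj {A : Matrix V V ℝ} (hA : A.IsSymm) {s : V → ℝ} {μ : ℝ}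
    (h : A *ᵥ s = μ • s) (l : ℕ) : Commute (A ^ l) (signProj s) := by
  have h1 := congrArg transpose (pow_mul_signProj h l)
  rw [transpose_mul, transpose_smul, (isSymm_signProj s).eq, (hA.pow l).eq] at h1
  rw [Commute, SemiconjBy, h1, pow_mul_signProj h l]

end Matrix

/-! ### Order bounds from closed walks -/

section Graph

open Matrix

variable {V : Type u} [Fintype V] [DecidableEq V] {G : SimpleGraph V} [DecidableRel G.Adj]
  {k l : ℕ} {a C : ℝ}

omit [DecidableEq V] in
theorem adjMatrix_mulVec_one (hk : G.IsRegularOfDegree k) :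
    G.adjMatrix ℝ *ᵥ (1 : V → ℝ) = (k : ℝ) • (1 : V → ℝ) := by
  ext v
  rw [adjMatrix_mulVec_apply]
  simp [hk v]

omit [DecidableEq V] in
theorem exists_sign_of_isBipartite (hk : G.IsRegularOfDegree k) (hk0 : k ≠ 0)
    (hb : G.IsBipartite) :
    ∃ s : V → ℝ, (∀ v, s v * s v = 1) ∧ G.adjMatrix ℝ *ᵥ s = (-k : ℝ) • s ∧
      (1 : V → ℝ) ⬝ᵥ s = 0 := by
  obtain ⟨col⟩ := hb
  have hs : G.adjMatrix ℝ *ᵥ (fun v => if col v = 0 then (1 : ℝ) else -1) =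
      (-k : ℝ) • fun v => if col v = 0 then (1 : ℝ) else -1 := by
    ext v
    rw [adjMatrix_mulVec_apply]
    have : ∀ w ∈ G.neighborFinset v, (if col w = 0 then (1 : ℝ) else -1) =
        -(if col v = 0 then (1 : ℝ) else -1) := fun w hw => by
      have hne := col.valid ((G.mem_neighborFinset v w).1 hw)
      have : col w = 0 ↔ ¬ col v = 0 := by omega
      simp only [this]
      split_ifs <;> simp
    rw [Finset.sum_congr rfl this, Finset.sum_const, card_neighborFinset_eq_degree, hk v]
    simp only [Pi.smul_apply, smul_eq_mul, nsmul_eq_mul, mul_neg, neg_mul]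
  refine ⟨_, fun v => by split_ifs <;> simp, hs, ?_⟩
  generalize (fun v => if col v = 0 then (1 : ℝ) else -1) = s at hs
  -- Eigenvectors of a symmetric matrix for `k ≠ -k` are orthogonal.
  have h1 : (1 : V → ℝ) ⬝ᵥ (G.adjMatrix ℝ *ᵥ s) = (G.adjMatrix ℝ *ᵥ (1 : V → ℝ)) ⬝ᵥ s := by
    rw [dotProduct_mulVec, ← mulVec_transpose, transpose_adjMatrix]
  rw [hs, adjMatrix_mulVec_one hk, dotProduct_smul, smul_dotProduct, smul_eq_mul, smul_eq_mul] at h1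
  have hk' : (k : ℝ) ≠ 0 := by exact_mod_cast hk0
  have h2 : (k : ℝ) * ((1 : V → ℝ) ⬝ᵥ s) = 0 := by linarith
  exact (mul_eq_zero.1 h2).resolve_left hk'

theorem trace_adjMatrix_pow (h : ∀ v, (G.adjMatrix ℝ ^ l) v v = a) :
    (G.adjMatrix ℝ ^ l).trace = Fintype.card V * a := by
  simp [Matrix.trace, h]

/-- A lower bound on the order of a regular graph whose numbers of closed walks of lengths `l` and
`2 * l` do not depend on the starting vertex. -/
theorem regular_order_bound [Nonempty V] (hk : G.IsRegularOfDegree k)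
    (ha : ∀ v, (G.adjMatrix ℝ ^ l) v v = a) (hC : ∀ v, (G.adjMatrix ℝ ^ (l + l)) v v = C) :
    C + (k : ℝ) ^ (l + l) - 2 * a * (k : ℝ) ^ l ≤ Fintype.card V * (C - a ^ 2) := by
  have hn : (0 : ℝ) < Fintype.card V := Nat.cast_pos.2 Fintype.card_pos
  have h1 := adjMatrix_mulVec_one hk
  have hs : ∀ v : V, (1 : V → ℝ) v * (1 : V → ℝ) v = 1 := by simp
  have h := trace_sub_sq_le ((G.isSymm_adjMatrix (α := ℝ)).pow l) (isSymm_signProj 1)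
    (commute_pow_signProj G.isSymm_adjMatrix h1 l) (signProj_mul_self hs)
  rw [← pow_add, pow_mul_signProj h1, pow_mul_signProj h1, trace_smul, trace_smul,
    trace_signProj hs, trace_adjMatrix_pow ha, trace_adjMatrix_pow hC, smul_eq_mul, smul_eq_mul,
    mul_one, mul_one, pow_add] at h
  rw [pow_add]
  -- Expanding `h`, the terms `k^(2l)` cancel and every other term carries a factor `n`.
  refine le_of_mul_le_mul_left ?_ hn
  linarith

omit [DecidableEq V] in
/-- The projection onto the sum of the eigenspaces for `k` and `-k` of a bipartite graph. -/
theorem signProj_add_mul_self [Nonempty V] {s : V → ℝ} (hs : ∀ v, s v * s v = 1)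
    (h0 : (1 : V → ℝ) ⬝ᵥ s = 0) :
    (signProj 1 + signProj s) * (signProj 1 + signProj s) = signProj 1 + signProj s := by
  have hs1 : ∀ v : V, (1 : V → ℝ) v * (1 : V → ℝ) v = 1 := by simp
  rw [add_mul, mul_add, mul_add, signProj_mul_self hs, signProj_mul_self hs1,
    signProj_mul_signProj 1 s, signProj_mul_signProj s 1, dotProduct_comm s 1, h0]
  simp

/-- For even `l` both `k` and `-k` contribute `k^l` to the trace, so Cauchy–Schwarz reads `(na -
2k^l)² ≤ (nC - 2k^(2l))(n - 2)`. -/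
theorem bipartite_order_bound [Nonempty V] (hk : G.IsRegularOfDegree k) (hk0 : k ≠ 0)
    (hb : G.IsBipartite) (hl : Even l)
    (ha : ∀ v, (G.adjMatrix ℝ ^ l) v v = a) (hC : ∀ v, (G.adjMatrix ℝ ^ (l + l)) v v = C) :
    2 * (C + (k : ℝ) ^ (l + l) - 2 * a * (k : ℝ) ^ l) ≤ Fintype.card V * (C - a ^ 2) := by
  have hn : (0 : ℝ) < Fintype.card V := Nat.cast_pos.2 Fintype.card_pos
  obtain ⟨s, hs, h2, h0⟩ := exists_sign_of_isBipartite hk hk0 hb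
  have h1 := adjMatrix_mulVec_one hk
  have hs1 : ∀ v : V, (1 : V → ℝ) v * (1 : V → ℝ) v = 1 := by simp
  have hA := G.isSymm_adjMatrix (α := ℝ)
  have h := trace_sub_sq_le (hA.pow l) ((isSymm_signProj 1).add (isSymm_signProj s))
    ((commute_pow_signProj hA h1 l).add_right (commute_pow_signProj hA h2 l))
    (signProj_add_mul_self hs h0)
  rw [← pow_add, mul_add, mul_add, pow_mul_signProj h1, pow_mul_signProj h1, pow_mul_signProj h2,
    pow_mul_signProj h2, hl.neg_pow, (hl.add hl).neg_pow] at h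
  simp only [trace_add, trace_smul, trace_signProj hs, trace_signProj hs1, smul_eq_mul, mul_one,
    trace_adjMatrix_pow ha, trace_adjMatrix_pow hC] at h
  rw [pow_add] at h ⊢
  refine le_of_mul_le_mul_left ?_ hn
  linarith

/-- The trace of `A^(2l)` is at least the contribution of `±k`, its other eigenvalues being squares.
-/
theorem bipartite_order_bound' [Nonempty V] (hk : G.IsRegularOfDegree k) (hk0 : k ≠ 0)
    (hb : G.IsBipartite) (hC : ∀ v, (G.adjMatrix ℝ ^ (l + l)) v v = C) :
    2 * (k : ℝ) ^ (l + l) ≤ Fintype.card V * C := by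
  obtain ⟨s, hs, h2, h0⟩ := exists_sign_of_isBipartite hk hk0 hb
  have h1 := adjMatrix_mulVec_one hk
  have hs1 : ∀ v : V, (1 : V → ℝ) v * (1 : V → ℝ) v = 1 := by simp
  have hA := G.isSymm_adjMatrix (α := ℝ)
  have h := trace_mul_self_sub_nonneg (hA.pow l) ((isSymm_signProj 1).add (isSymm_signProj s))
    ((commute_pow_signProj hA h1 l).add_right (commute_pow_signProj hA h2 l))
    (signProj_add_mul_self hs h0)
  rw [← pow_add, mul_add, pow_mul_signProj h1, pow_mul_signProj h2,
    (Even.add_self l).neg_pow] at h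
  simp only [trace_add, trace_smul, trace_signProj hs, trace_signProj hs1, smul_eq_mul, mul_one,
    trace_adjMatrix_pow hC] at h
  linarith

/-- In a graph of minimum degree at least `2`, some vertex `w ≠ v` is reached from `v` by a walk of
any prescribed positive even length. -/
theorem exists_ne_adjMatrix_pow_pos (hk : G.IsRegularOfDegree k) (hk2 : 2 ≤ k) (v : V)
    (hl : Even l) (hl0 : l ≠ 0) : ∃ w, w ≠ v ∧ 0 < (G.adjMatrix ℕ ^ l) v w := by
  obtain ⟨x, hx⟩ : (G.neighborFinset v).Nonempty := by
    rw [← Finset.card_pos, card_neighborFinset_eq_degree, hk v]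
    omega
  rw [mem_neighborFinset] at hx
  obtain ⟨w, hw, hwv⟩ := Finset.exists_mem_ne (s := G.neighborFinset x)
    (by rw [card_neighborFinset_eq_degree, hk x]; omega) v
  rw [mem_neighborFinset] at hw
  -- Shuttling along the edge `vx` lengthens the walk by two.
  have hwalk : ∀ j, ∃ p : G.Walk v w, p.length = j + j + 2 := fun j => by
    induction j with
    | zero => exact ⟨Walk.cons hx (Walk.cons hw Walk.nil), rfl⟩
    | succ j ih =>
      obtain ⟨p, hp⟩ := ih
      refine ⟨Walk.cons hx (Walk.cons hx.symm p), ?_⟩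
      rw [Walk.length_cons, Walk.length_cons, hp]
      ring
  obtain ⟨i, rfl⟩ := hl
  obtain ⟨p, hp⟩ := hwalk (i - 1)
  refine ⟨w, hwv, ?_⟩
  rw [adjMatrix_pow_apply_eq_ncard, Set.ncard_pos (finite_walks_length v w _)]
  exact ⟨p, by rw [Set.mem_ofPred_eq, hp]; omega⟩

/-- By symmetry the right side is the sum over `w` of the squared `(v, w)` entries of `A^l`, and
some `w ≠ v` contributes. This makes the denominator positive when `4 ∣ g`. -/
theorem sq_adjMatrix_pow_diag_lt (hk : G.IsRegularOfDegree k) (hk2 : 2 ≤ k) (v : V)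
    (hl : Even l) (hl0 : l ≠ 0) :
    (G.adjMatrix ℕ ^ l) v v ^ 2 < (G.adjMatrix ℕ ^ (l + l)) v v := by
  obtain ⟨w, hwv, hw⟩ := exists_ne_adjMatrix_pow_pos hk hk2 v hl hl0
  have hsymm : ∀ x, (G.adjMatrix ℕ ^ l) x v = (G.adjMatrix ℕ ^ l) v x :=
    fun x => ((G.isSymm_adjMatrix (α := ℕ)).pow l).apply v x
  rw [pow_add, Matrix.mul_apply]
  simp only [hsymm, ← sq]
  have h := Finset.sum_le_sum_of_subset (f := fun x => (G.adjMatrix ℕ ^ l) v x ^ 2)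
    (Finset.subset_univ {v, w})
  rw [Finset.sum_pair hwv.symm] at h
  have : 0 < (G.adjMatrix ℕ ^ l) v w ^ 2 := by positivity
  omega

end Graph

/-! ### Isomorphism invariance -/

section Iso

variable {V W : Type*} {G : SimpleGraph V} {G' : SimpleGraph W}

theorem IsCycleSubgraph.map {g : ℕ} {H : G.Subgraph} (hH : IsCycleSubgraph G g H) (f : G →g G')
    (hf : Function.Injective f) : IsCycleSubgraph G' g (H.map f) := by
  obtain ⟨v, p, hp, hl, rfl⟩ := hH
  exact ⟨f v, p.map f, hp.map hf, by rw [Walk.length_map, hl], Walk.toSubgraph_map f p⟩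

theorem subgraph_map_symm_map (φ : G ≃g G') (H : G.Subgraph) :
    (H.map φ.toHom).map φ.symm.toHom = H := by
  rw [← Subgraph.map_comp]
  convert Subgraph.map_id H
  ext v
  exact φ.symm_apply_apply v

theorem ncard_isCycleSubgraph_le [Finite W] (φ : G ≃g G') (g : ℕ) (e : Sym2 V) :
    {H : G.Subgraph | IsCycleSubgraph G g H ∧ e ∈ H.edgeSet}.ncard ≤
      {H : G'.Subgraph | IsCycleSubgraph G' g H ∧ e.map φ ∈ H.edgeSet}.ncard := by
  refine Set.ncard_le_ncard_of_injOn (fun H => H.map φ.toHom) ?_ ?_ (Set.toFinite _)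
  · rintro H ⟨hH, he⟩
    refine ⟨hH.map _ φ.injective, ?_⟩
    rw [Subgraph.edgeSet_map]
    exact ⟨e, he, rfl⟩
  · intro H _ H' _ heq
    rw [← subgraph_map_symm_map φ H, ← subgraph_map_symm_map φ H']
    exact congrArg _ heq

theorem ncard_isCycleSubgraph_eq [Finite V] [Finite W] (φ : G ≃g G') (g : ℕ) (e : Sym2 V) :
    {H : G.Subgraph | IsCycleSubgraph G g H ∧ e ∈ H.edgeSet}.ncard =
      {H : G'.Subgraph | IsCycleSubgraph G' g H ∧ e.map φ ∈ H.edgeSet}.ncard := by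
  refine (ncard_isCycleSubgraph_le φ g e).antisymm ?_
  have h := ncard_isCycleSubgraph_le φ.symm g (e.map φ)
  have he : (e.map φ).map φ.symm = e := by
    rw [Sym2.map_map, show φ.symm ∘ φ = id from funext φ.symm_apply_apply, Sym2.map_id, id]
  rwa [he] at h

theorem IsEGR.of_iso [Fintype V] [Fintype W] [DecidableRel G.Adj] [DecidableRel G'.Adj]
    {n k g lam : ℕ} (hG : IsEGR G n k g lam) (φ : G ≃g G') : IsEGR G' n k g lam where
  order := by rw [← Fintype.card_congr φ.toEquiv, hG.order]
  regular w := by rw [← φ.symm.degree_eq w, hG.regular]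
  girth := by rw [← φ.egirth_eq, hG.girth]
  cycles e he := by
    obtain ⟨e, rfl⟩ : ∃ e' : Sym2 V, e'.map φ = e := ⟨e.map φ.symm, by
      rw [Sym2.map_map, show φ ∘ φ.symm = id from funext φ.apply_symm_apply, Sym2.map_id, id]⟩
    rw [← ncard_isCycleSubgraph_eq φ]
    refine hG.cycles e ?_
    induction e with
    | h x y => exact φ.map_adj_iff.1 he

/-- Transport to `Fin n` makes the set nonempty, so that its `sInf` is attained rather than the
default `0`. -/
theorem IsEGR.order_mem_orders [Fintype V] [DecidableRel G.Adj] {n k g lam : ℕ}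
    (hG : IsEGR G n k g lam) : n ∈ orders k g lam := by
  classical
  exact ⟨G.overFin hG.order, inferInstance, hG.of_iso (G.overFinIso hG.order)⟩

end Iso

/-! ### The bounds in terms of closed walks in trees -/

section Bounds

variable {V : Type u} [Fintype V] {G : SimpleGraph V} [DecidableRel G.Adj] {n k g lam : ℕ}

/-- Closed walks in trees have even length. -/
theorem treeCount_eq_zero_of_odd (k i : ℕ) : ∀ j, Odd (i + j) → treeCount k i j = 0 := by
  induction i with
  | zero =>
    rintro (_ | j) hj
    · simp at hj
    · rw [treeCount]
  | succ i ih =>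
    rintro (_ | _ | j) hj
    · rw [treeCount, ih 1 hj]
    · rw [treeCount, ih 2 (by grind), ih 0 (by grind)]
      rfl
    · rw [treeCount, ih (j + 3) (by grind), ih (j + 1) (by grind)]
      rfl

theorem IsEGR.nonempty (hG : IsEGR G n k g lam) : Nonempty V :=
  let ⟨v, _⟩ := hG.exists_isCycle
  ⟨v⟩

theorem IsEGR.pow_half_diag [DecidableEq V] (hG : IsEGR G n k g lam) {l : ℕ} (hl : g = l + l)
    (v : V) : (G.adjMatrix ℕ ^ l) v v = treeCount k l 0 := by
  have := hG.three_le
  rw [hG.pow_diag v (by omega), if_neg (by omega), add_zero]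

theorem IsEGR.pow_girth_diag [DecidableEq V] (hG : IsEGR G n k g lam) (v : V) :
    (G.adjMatrix ℕ ^ g) v v = treeCount k g 0 + k * lam := by
  rw [hG.pow_diag v le_rfl, if_pos rfl]

theorem adjMatrix_pow_apply_natCast [DecidableEq V] (l : ℕ) (u v : V) :
    (G.adjMatrix ℝ ^ l) u v = ((G.adjMatrix ℕ ^ l) u v : ℕ) := by
  rw [adjMatrix_pow_apply_eq_card_walk, adjMatrix_pow_apply_eq_card_walk]
  simp

theorem IsEGR.pow_half_diag_real [DecidableEq V] (hG : IsEGR G n k g lam) {l : ℕ}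
    (hl : g = l + l) (v : V) : (G.adjMatrix ℝ ^ l) v v = treeCount k l 0 := by
  rw [adjMatrix_pow_apply_natCast, hG.pow_half_diag hl]

theorem IsEGR.pow_girth_diag_real [DecidableEq V] (hG : IsEGR G n k g lam) {l : ℕ}
    (hl : g = l + l) (v : V) :
    (G.adjMatrix ℝ ^ (l + l)) v v = treeCount k g 0 + k * lam := by
  rw [adjMatrix_pow_apply_natCast, ← hl, hG.pow_girth_diag]
  push_cast
  rfl

theorem IsEGR.treeCount_pos (hG : IsEGR G n k g lam) {l : ℕ} (hl : g = l + l) (hle : Even l) :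
    (0 : ℝ) < treeCount k g 0 - (treeCount k l 0 : ℝ) ^ 2 + k * lam := by
  classical
  obtain ⟨v⟩ := hG.nonempty
  have h3 := hG.three_le
  have h := sq_adjMatrix_pow_diag_lt hG.regular hG.two_le v hle (by omega)
  rw [← hl, hG.pow_half_diag hl, hG.pow_girth_diag] at h
  have h' : (treeCount k l 0 : ℝ) ^ 2 < treeCount k g 0 + k * lam := by exact_mod_cast h
  linarith

theorem IsEGR.order_bound (hG : IsEGR G n k g lam) {l : ℕ} (hl : g = l + l) :
    (treeCount k g 0 : ℝ) + k * lam + (k : ℝ) ^ g - 2 * treeCount k l 0 * (k : ℝ) ^ l ≤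
      n * (treeCount k g 0 - (treeCount k l 0 : ℝ) ^ 2 + k * lam) := by
  classical
  have := hG.nonempty
  have h := regular_order_bound hG.regular (hG.pow_half_diag_real hl) (hG.pow_girth_diag_real hl)
  rw [← hl, hG.order] at h
  linarith

theorem IsEGR.bipartite_order_bound (hG : IsEGR G n k g lam) (hb : G.IsBipartite) {l : ℕ}
    (hl : g = l + l) (hle : Even l) :
    2 * ((treeCount k g 0 : ℝ) + k * lam + (k : ℝ) ^ g - 2 * treeCount k l 0 * (k : ℝ) ^ l) ≤
      n * (treeCount k g 0 - (treeCount k l 0 : ℝ) ^ 2 + k * lam) := by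
  classical
  have := hG.nonempty
  have h2 := hG.two_le
  have h := EdgeGirthRegular.bipartite_order_bound hG.regular (by omega) hb hle
    (hG.pow_half_diag_real hl) (hG.pow_girth_diag_real hl)
  rw [← hl, hG.order] at h
  linarith

theorem IsEGR.bipartite_order_bound' (hG : IsEGR G n k g lam) (hb : G.IsBipartite) {l : ℕ}
    (hl : g = l + l) : 2 * (k : ℝ) ^ g ≤ n * (treeCount k g 0 + k * lam) := by
  classical
  have := hG.nonempty
  have h2 := hG.two_le
  have h := EdgeGirthRegular.bipartite_order_bound' hG.regular (by omega) hb
    (hG.pow_girth_diag_real hl)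
  rwa [← hl, hG.order] at h

end Bounds

end EdgeGirthRegular

open EdgeGirthRegular in
theorem mainTheorem1 {V : Type u} [Fintype V] (G : SimpleGraph V) [DecidableRel G.Adj]
    (n k g lam : ℕ) (hG : IsEGR G n k g lam) (hg : Even g) (v : V) :
    (g % 4 = 0 →
      0 < (c G v g : ℝ) - (c G v (g / 2) : ℝ) ^ 2 + k * lam ∧
      ((c G v g : ℝ) + k * lam + (k : ℝ) ^ g - 2 * c G v (g / 2) * (k : ℝ) ^ (g / 2)) /
          ((c G v g : ℝ) - (c G v (g / 2) : ℝ) ^ 2 + k * lam)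
        ≤ (minOrder k g lam : ℝ) ∧
      ((bipartiteOrders k g lam).Nonempty →
        2 * (((c G v g : ℝ) + k * lam + (k : ℝ) ^ g - 2 * c G v (g / 2) * (k : ℝ) ^ (g / 2)) /
            ((c G v g : ℝ) - (c G v (g / 2) : ℝ) ^ 2 + k * lam))
          ≤ (minBipartiteOrder k g lam : ℝ))) ∧
    (g % 4 = 2 →
      0 < (c G v g : ℝ) + k * lam ∧
      ((c G v g : ℝ) + k * lam + (k : ℝ) ^ g) / ((c G v g : ℝ) + k * lam)
        ≤ (minOrder k g lam : ℝ) ∧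
      ((bipartiteOrders k g lam).Nonempty →
        2 * (k : ℝ) ^ g / ((c G v g : ℝ) + k * lam) ≤ (minBipartiteOrder k g lam : ℝ))) := by
  obtain ⟨l, hl⟩ := hg
  obtain ⟨H, _, hH⟩ : minOrder k g lam ∈ orders k g lam := Nat.sInf_mem ⟨n, hG.order_mem_orders⟩
  have hbip : (bipartiteOrders k g lam).Nonempty →
      minBipartiteOrder k g lam ∈ bipartiteOrders k g lam := Nat.sInf_mem
  have hl2 : g / 2 = l := by omega
  rw [hl2, hG.c_eq v le_rfl, hG.c_eq v (by omega : l ≤ g)]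
  have hbound := hH.order_bound hl
  constructor
  · intro h4
    have hle : Even l := Nat.even_iff.2 (by omega)
    have hpos := hG.treeCount_pos hl hle
    refine ⟨hpos, (div_le_iff₀ hpos).2 hbound, fun hne => ?_⟩
    obtain ⟨H', _, hH', hb⟩ := hbip hne
    rw [← mul_div_assoc, div_le_iff₀ hpos]
    exact hH'.bipartite_order_bound hb hl hle
  · intro h4
    have hlo : Odd l := Nat.odd_iff.2 (by omega)
    -- With `a = 0`, both the square and the linear correction disappear.
    rw [treeCount_eq_zero_of_odd k l 0 hlo] at hbound
    have hbound' : (treeCount k g 0 : ℝ) + k * lam + (k : ℝ) ^ g ≤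
        minOrder k g lam * (treeCount k g 0 + k * lam) := by
      norm_num at hbound
      exact hbound
    have hpos : (0 : ℝ) < treeCount k g 0 + k * lam := by
      have hk : (0 : ℝ) < k := Nat.cast_pos.2 (by have := hG.two_le; omega)
      have h0 : (0 : ℝ) ≤ treeCount k g 0 + k * lam := by positivity
      -- A zero denominator would turn the bound into `k ^ g ≤ 0`.
      refine h0.lt_of_ne fun h => ?_
      rw [← h] at hbound'
      have := pow_pos hk g
      linarith
    refine ⟨hpos, (div_le_iff₀ hpos).2 hbound', fun hne => ?_⟩
    obtain ⟨H', _, hH', hb⟩ := hbip hne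
    rw [div_le_iff₀ hpos]
    exact hH'.bipartite_order_bound' hb hl
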